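/- Let $\Lambda=(\lambda_i)_{i=0}^\infty$ be a strictly increasing sequence of real numbers with $\lambda_0=0$ and $\sum_{i=1}^\infty 1/\lambda_i<\infty$. Let $C[0,1]$ be the space of real-valued continuous functions on $[0,1]$ with the supremum norm, let the Müntz space $M(\Lambda)$ be the closed linear span of $\{t^{\lambda_i} : i\ge 0\}$ in $C[0,1]$, and let $M_0(\Lambda)$ be the closed linear span of $\{t^{\lambda_i} : i\ge 1\}$ in $C[0,1]$. A real Banach space $X$ is called almost square (ASQ) if for every $k\ge 1$ and all $x_1,\dots,x_k\in X$ with $\|x_i\|=1$ there is a sequence $(y_n)$ in $X$ with $\|y_n\|\le 1$ for all $n$, such that $\|y_n\|\to 1$ and, for every $i\in\{1,\dots,k\}$, $\|x_i+y_n\|\to 1$ and $\|x_i-y_n\|\to 1$. Then $M(\Lambda)$ is not almost square, and neither is $M_0(\Lambda)$. -/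

import Mathlib

open Filter Topology
open scoped NNReal unitInterval

/-- The continuous function `t ↦ t ^ a` on `[0,1]`, for a real exponent `a ≥ 0`
(for `a = 0` it is the constant function `1`). -/
noncomputable def muntzPower (a : ℝ≥0) : C(I, ℝ) where
  toFun t := (t : ℝ) ^ (a : ℝ)
  continuous_toFun := continuous_subtype_val.rpow_const fun _ => Or.inr a.2

/-- A Müntz sequence: a strictly increasing sequence `0 = Λ 0 < Λ 1 < …` of nonnegative reals
such that the sum of `1 / Λ i` over `i ≥ 1` is finite. -/
structure IsMuntzSequence (Λ : ℕ → ℝ≥0) : Prop where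
  zero : Λ 0 = 0
  strictMono : StrictMono Λ
  summable : Summable fun i : ℕ => 1 / (Λ (i + 1) : ℝ)

/-- The space `M(Λ)`: the closed linear span of `t ^ Λ i`, `i ≥ 0`, in `C[0,1]` with the
supremum norm. -/
noncomputable def muntzSpace (Λ : ℕ → ℝ≥0) : Submodule ℝ C(I, ℝ) :=
  (Submodule.span ℝ (Set.range fun i : ℕ => muntzPower (Λ i))).topologicalClosure

/-- The space `M₀(Λ)`: the closed linear span of `t ^ Λ i`, `i ≥ 1`, in `C[0,1]` with the
supremum norm. -/
noncomputable def muntzSpaceZero (Λ : ℕ → ℝ≥0) : Submodule ℝ C(I, ℝ) :=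
  (Submodule.span ℝ (Set.range fun i : ℕ => muntzPower (Λ (i + 1)))).topologicalClosure

/-- A normed space `X` is almost square if for any finitely many `x₁, …, x_k` in the unit sphere
there is a sequence `(y n)` in the closed unit ball such that `‖y n‖ → 1` and `‖x_i ± y n‖ → 1`
for every `i`. -/
def IsAlmostSquare (X : Type*) [NormedAddCommGroup X] [NormedSpace ℝ X] : Prop :=
  ∀ (k : ℕ), 1 ≤ k → ∀ x : Fin k → X, (∀ i, x i ∈ Metric.sphere (0 : X) 1) →
    ∃ y : ℕ → X, (∀ n, y n ∈ Metric.closedBall (0 : X) 1) ∧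
      Tendsto (fun n => ‖y n‖) atTop (𝓝 1) ∧
      ∀ i, Tendsto (fun n => ‖x i + y n‖) atTop (𝓝 1) ∧
        Tendsto (fun n => ‖x i - y n‖) atTop (𝓝 1)

/-!
Neither space has enough functions concentrated away from a suitable norm-one function `x`.

In `M(Λ)` take `x = 1`: one of `‖1 + y‖`, `‖1 - y‖` is always `1 + ‖y‖`.

In `M₀(Λ)` take `x = t ^ Λ 1`, which is bounded below on every `[δ, 1]`. A function `y` with
`‖y‖ ≈ 1` and `‖x ± y‖ ≈ 1` would have to peak arbitrarily close to `0`, so it suffices that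
`|y t| ≤ ‖y‖ / 2` for all `y ∈ M₀(Λ)` and `t ≤ δ`, with one `δ > 0` for all `y`
(`exists_abs_apply_le_half_norm`). With `t = e^{-s}` this is a statement about exponential sums
`P(s) = ∑ a i e^{-l i s}` with `|P| ≤ C` on `[0, ∞)`, uniform in the number of terms, and it is
proved through the Cauchy transform `R(z) = ∑ a i / (l i - z)`:

* On the line `Re z = -1` the function `R` is a Laplace transform of `P(s) e^{-s}`, hence bounded
  by `C`. Multiplying `R` by the Blaschke product of its poles for the half plane `Re z > -1` and
  using the Phragmén–Lindelöf principle gives `|R| ≤ C / |B|` there (`norm_sum_div_sub_le_prod`).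
* On the rays `arg z = ±π/4` the summability of the `1 / l i` gives
  `1 / |B(z)| ≤ exp (4 K (1 + Re z))` (`norm_sum_div_sub_le_exp`).
* The residue theorem writes `2πi P(s)` as an integral of `e^{-zs} R(z)` over the two rays
  (`triangleIntegral_exp_mul_sum`), so `P(s) = O(C / s)` (`abs_sum_exp_le_div`).

No gap condition on the exponents is needed, since the coefficients `a i` are never estimated
individually.
-/

/-! ### Contour integration over a triangle -/

theorem integral_segment_eq_sub {F f : ℂ → ℂ} {a b : ℂ} {u v : ℝ}
    (hF : ∀ x ∈ Set.uIcc u v, HasDerivAt F (f (a + b * x)) (a + b * x))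
    (hf : ContinuousOn (fun x : ℝ => f (a + b * x)) (Set.uIcc u v)) :
    ∫ x in u..v, b * f (a + b * x) = F (a + b * v) - F (a + b * u) := by
  refine intervalIntegral.integral_eq_sub_of_hasDerivAt (f := fun x : ℝ => F (a + b * x))
    (fun x hx => ?_) (hf.const_mul b).intervalIntegrable
  have h1 : HasDerivAt (fun x : ℝ => a + b * (x : ℂ)) b x := by
    simpa using ((Complex.ofRealCLM.hasDerivAt (x := x)).const_mul b).const_add a
  simpa [mul_comm, Function.comp_def] using (hF x hx).scomp x h1

theorem Complex.log_neg_of_im_pos {z : ℂ} (hz : 0 < z.im) :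
    Complex.log (-z) = Complex.log z - Real.pi * Complex.I := by
  simp only [Complex.log, Complex.arg_neg_eq_arg_sub_pi_of_im_pos hz, norm_neg]
  push_cast
  ring

/-- The integral of `f` along the boundary of the triangle with vertices `0`, `X (1 - i)`,
`X (1 + i)`, traversed in this order. -/
noncomputable def triangleIntegral (f : ℂ → ℂ) (X : ℝ) : ℂ :=
  (∫ x in (0 : ℝ)..X, (1 - Complex.I) * f ((1 - Complex.I) * x)) +
    (∫ y in (-X)..X, Complex.I * f (X + Complex.I * y)) -
      ∫ x in (0 : ℝ)..X, (1 + Complex.I) * f ((1 + Complex.I) * x)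

theorem sub_one_add_I_mul_mem_slitPlane {l : ℝ} (hl : 0 < l) (x : ℝ) :
    (l : ℂ) - (1 + Complex.I) * x ∈ Complex.slitPlane := by
  rw [Complex.mem_slitPlane_iff]
  by_cases hx : x = 0
  · left; simp [hx, hl]
  · right; simpa using hx

theorem sub_one_sub_I_mul_mem_slitPlane {l : ℝ} (hl : 0 < l) (x : ℝ) :
    (l : ℂ) - (1 - Complex.I) * x ∈ Complex.slitPlane := by
  rw [Complex.mem_slitPlane_iff]
  by_cases hx : x = 0
  · left; simp [hx, hl]
  · right; simpa using hx

theorem add_I_mul_sub_mem_slitPlane {l X : ℝ} (hX : l < X) (y : ℝ) :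
    (X : ℂ) + Complex.I * y - l ∈ Complex.slitPlane := by
  rw [Complex.mem_slitPlane_iff]
  left; simpa using hX

/-- Cauchy's formula for a triangle enclosing the real pole `l`. After the removable singularity
has been split off, the two slanted sides see the branch `log (l - z)` and the vertical side the
branch `log (z - l)`; the jumps between them add up to `-2πi`. -/
theorem triangleIntegral_div_sub {g : ℂ → ℂ} (hg : Differentiable ℂ g) {l X : ℝ} (hl : 0 < l)
    (hX : l < X) :
    triangleIntegral (fun z => g z / (l - z)) X = -(2 * Real.pi * Complex.I) * g l := by
  have hd : Differentiable ℂ (dslope g l) := by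
    rw [← differentiableOn_univ, Complex.differentiableOn_dslope Filter.univ_mem]
    exact hg.differentiableOn
  obtain ⟨G, hG⟩ := hd.isExactOn_univ
  have hG' : ∀ z, HasDerivAt G (dslope g l z) z := fun z => hG z (Set.mem_univ z)
  have key : ∀ z : ℂ, (l : ℂ) - z ≠ 0 → g z / (l - z) = -dslope g l z + g l * (1 / (l - z)) := by
    intro z hz
    have hz' : z - l ≠ 0 := by rw [← neg_sub]; exact neg_ne_zero.2 hz
    rw [dslope_of_ne _ (sub_ne_zero.1 hz'), slope_def_field]
    rw [← neg_sub (l : ℂ) z]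
    field_simp
    ring
  have hleft : ∀ z : ℂ, (l : ℂ) - z ∈ Complex.slitPlane →
      HasDerivAt (fun z => -G z - g l * Complex.log (l - z)) (g z / (l - z)) z := by
    intro z hz
    rw [key z (Complex.slitPlane_ne_zero hz)]
    have h := ((hG' z).neg).sub ((((hasDerivAt_id z).const_sub (l : ℂ)).clog hz).const_mul (g l))
    refine HasDerivAt.congr_deriv h ?_
    simp only [id]
    ring
  have hright : ∀ z : ℂ, z - (l : ℂ) ∈ Complex.slitPlane →
      HasDerivAt (fun z => -G z - g l * Complex.log (z - l)) (g z / (l - z)) z := by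
    intro z hz
    have hz' := Complex.slitPlane_ne_zero hz
    rw [key z (by rw [← neg_sub]; exact neg_ne_zero.2 hz')]
    have h := ((hG' z).neg).sub ((((hasDerivAt_id z).sub_const (l : ℂ)).clog hz).const_mul (g l))
    refine HasDerivAt.congr_deriv h ?_
    simp only [id]
    rw [← neg_sub z (l : ℂ)]
    field_simp
    ring
  have hcont : ∀ (b a : ℂ), (∀ x : ℝ, (l : ℂ) - (a + b * x) ≠ 0) →
      Continuous fun x : ℝ => g (a + b * x) / (l - (a + b * x)) := by
    intro b a h
    exact (hg.continuous.comp (by fun_prop)).div (by fun_prop) h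
  have hU := integral_segment_eq_sub (f := fun z => g z / (l - z)) (a := 0) (b := 1 + Complex.I)
    (u := 0) (v := X) (fun x _ => hleft _ (by
      simpa only [zero_add] using sub_one_add_I_mul_mem_slitPlane hl x))
    (hcont _ _ fun x => Complex.slitPlane_ne_zero (by
      simpa only [zero_add] using sub_one_add_I_mul_mem_slitPlane hl x)).continuousOn
  have hL := integral_segment_eq_sub (f := fun z => g z / (l - z)) (a := 0) (b := 1 - Complex.I)
    (u := 0) (v := X) (fun x _ => hleft _ (by
      simpa only [zero_add] using sub_one_sub_I_mul_mem_slitPlane hl x))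
    (hcont _ _ fun x => Complex.slitPlane_ne_zero (by
      simpa only [zero_add] using sub_one_sub_I_mul_mem_slitPlane hl x)).continuousOn
  have hV := integral_segment_eq_sub (f := fun z => g z / (l - z)) (a := X) (b := Complex.I)
    (u := -X) (v := X) (fun x _ => hright _ (add_I_mul_sub_mem_slitPlane hX x))
    (hcont _ _ fun x => by
      rw [← neg_sub]
      exact neg_ne_zero.2
        (Complex.slitPlane_ne_zero (add_I_mul_sub_mem_slitPlane hX x))).continuousOn
  simp only [zero_add, Complex.ofReal_zero, mul_zero] at hU hL
  have e1 : (X : ℂ) + Complex.I * X = (1 + Complex.I) * X := by ring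
  have e2 : (X : ℂ) + Complex.I * ((-X : ℝ) : ℂ) = (1 - Complex.I) * X := by push_cast; ring
  rw [e1, e2] at hV
  have hX0 : 0 < X := hl.trans hX
  have l1 := Complex.log_neg_of_im_pos (z := (1 + Complex.I) * X - l) (by simpa using hX0)
  have l2 := Complex.log_neg_of_im_pos (z := l - (1 - Complex.I) * X) (by simpa using hX0)
  rw [neg_sub] at l1 l2
  rw [triangleIntegral, hU, hL, hV, l1, l2]
  ring

theorem triangleIntegral_sum {ι : Type*} {F : Finset ι} {f : ι → ℂ → ℂ} {X : ℝ}
    (hL : ∀ i ∈ F, Continuous fun x : ℝ => f i ((1 - Complex.I) * x))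
    (hV : ∀ i ∈ F, Continuous fun y : ℝ => f i (X + Complex.I * y))
    (hU : ∀ i ∈ F, Continuous fun x : ℝ => f i ((1 + Complex.I) * x)) :
    triangleIntegral (fun z => ∑ i ∈ F, f i z) X = ∑ i ∈ F, triangleIntegral (f i) X := by
  simp only [triangleIntegral, Finset.mul_sum]
  rw [intervalIntegral.integral_finsetSum, intervalIntegral.integral_finsetSum,
    intervalIntegral.integral_finsetSum, Finset.sum_sub_distrib, Finset.sum_add_distrib]
  · exact fun i hi => ((hU i hi).const_mul _).intervalIntegrable _ _
  · exact fun i hi => ((hV i hi).const_mul _).intervalIntegrable _ _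
  · exact fun i hi => ((hL i hi).const_mul _).intervalIntegrable _ _

/-! ### The Cauchy transform of an exponential sum -/

/-- The Laplace transform of `P(s) e^{-s}`, where `P` is an exponential sum bounded by `C`, is
bounded by `C` on the imaginary axis. -/
theorem norm_sum_div_le_of_abs_sum_exp_le {ι : Type*} {F : Finset ι} {a l : ι → ℝ} {C : ℝ}
    (hl : ∀ i ∈ F, 0 < l i)
    (hC : ∀ s : ℝ, 0 ≤ s → |∑ i ∈ F, a i * Real.exp (-(l i * s))| ≤ C) (y : ℝ) :
    ‖∑ i ∈ F, (a i : ℂ) / ((l i : ℂ) + 1 - y * Complex.I)‖ ≤ C := by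
  have hre : ∀ i ∈ F, (-((l i : ℂ) + 1 - y * Complex.I)).re < 0 := by
    intro i hi
    have := hl i hi
    simp; linarith
  have hint : ∀ i ∈ F, ∫ s in Set.Ioi (0 : ℝ),
      (a i : ℂ) * Complex.exp (-((l i : ℂ) + 1 - y * Complex.I) * s) =
        a i / ((l i : ℂ) + 1 - y * Complex.I) := by
    intro i hi
    rw [MeasureTheory.integral_const_mul, integral_exp_mul_complex_Ioi (hre i hi)]
    simp only [Complex.ofReal_zero, mul_zero, Complex.exp_zero, div_neg, neg_div, neg_neg]
    ring
  rw [← Finset.sum_congr rfl hint, ← MeasureTheory.integral_finsetSum]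
  · have hexp : ∫ s in Set.Ioi (0 : ℝ), C * Real.exp (-s) = C := by
      rw [MeasureTheory.integral_const_mul, integral_exp_neg_Ioi_zero, mul_one]
    calc _ ≤ ∫ s in Set.Ioi (0 : ℝ), C * Real.exp (-s) := by
          refine MeasureTheory.norm_integral_le_of_norm_le
            ((integrableOn_exp_neg_Ioi 0).const_mul C) ?_
          refine (MeasureTheory.ae_restrict_iff' measurableSet_Ioi).2
            (Filter.Eventually.of_forall fun s hs => ?_)
          have : ∑ i ∈ F, (a i : ℂ) * Complex.exp (-((l i : ℂ) + 1 - y * Complex.I) * s) =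
              ((∑ i ∈ F, a i * Real.exp (-(l i * s)) : ℝ) : ℂ) *
                Complex.exp ((-s : ℝ) + (y * s : ℝ) * Complex.I) := by
            push_cast
            rw [Finset.sum_mul]
            refine Finset.sum_congr rfl fun i _ => ?_
            rw [mul_assoc, ← Complex.exp_add]
            congr 2
            ring
          rw [this, norm_mul, Complex.norm_real, Complex.norm_exp]
          have h := hC s (le_of_lt hs)
          simp only [Complex.add_re, Complex.ofReal_re, Complex.mul_re, Complex.I_re, mul_zero,
            Complex.ofReal_im, Complex.I_im, mul_one, sub_self, add_zero]
          exact mul_le_mul_of_nonneg_right h (Real.exp_pos _).le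
      _ = C := hexp
  · intro i hi
    exact (integrableOn_exp_mul_complex_Ioi (hre i hi) 0).const_mul _

theorem norm_sub_le_norm_add_of_re_nonneg {m : ℝ} (hm : 0 ≤ m) {w : ℂ} (hw : 0 ≤ w.re) :
    ‖(m : ℂ) - w‖ ≤ ‖(m : ℂ) + w‖ := by
  rw [← sq_le_sq₀ (norm_nonneg _) (norm_nonneg _), ← Complex.normSq_eq_norm_sq,
    ← Complex.normSq_eq_norm_sq, Complex.normSq_apply, Complex.normSq_apply]
  simp
  nlinarith [mul_nonneg hm hw]

theorem norm_sub_eq_norm_add_of_re_eq_zero (m y : ℝ) :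
    ‖(m : ℂ) - y * Complex.I‖ = ‖(m : ℂ) + y * Complex.I‖ := by
  rw [← sq_eq_sq₀ (norm_nonneg _) (norm_nonneg _), ← Complex.normSq_eq_norm_sq,
    ← Complex.normSq_eq_norm_sq, Complex.normSq_apply, Complex.normSq_apply]
  simp

theorem ofReal_add_ne_zero_of_re_nonneg {m : ℝ} (hm : 0 < m) {w : ℂ} (hw : 0 ≤ w.re) :
    (m : ℂ) + w ≠ 0 := by
  intro h
  have := congrArg Complex.re h
  simp at this
  linarith

/-- A sum of simple fractions with poles `m i > 0` that is bounded by `C` on the imaginary axis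
satisfies `|R(w)| ≤ C / |B(w)|` in the right half plane, where `B` is the Blaschke product of the
poles: `B R` is holomorphic and bounded there and has the same modulus as `R` on the boundary, so
the Phragmén–Lindelöf principle applies. -/
theorem norm_sum_div_sub_le_prod {ι : Type*} [DecidableEq ι] {F : Finset ι} {a m : ι → ℝ} {C : ℝ}
    (hm : ∀ i ∈ F, 0 < m i)
    (hC : ∀ y : ℝ, ‖∑ i ∈ F, (a i : ℂ) / ((m i : ℂ) - y * Complex.I)‖ ≤ C)
    {w : ℂ} (hw : 0 ≤ w.re) (hmw : ∀ i ∈ F, (m i : ℂ) - w ≠ 0) :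
    ‖∑ i ∈ F, (a i : ℂ) / ((m i : ℂ) - w)‖ ≤ C * ∏ i ∈ F, (‖(m i : ℂ) + w‖ / ‖(m i : ℂ) - w‖) := by
  -- `H` is the product of the sum and the Blaschke product, with the poles cancelled.
  let H : ℂ → ℂ := fun w => ∑ j ∈ F, (a j : ℂ) / ((m j : ℂ) + w) *
    ∏ i ∈ F.erase j, (((m i : ℂ) - w) / ((m i : ℂ) + w))
  have hH : ∀ w : ℂ, 0 ≤ w.re → (∀ i ∈ F, (m i : ℂ) - w ≠ 0) →
      H w = (∑ i ∈ F, (a i : ℂ) / ((m i : ℂ) - w)) *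
        ∏ i ∈ F, (((m i : ℂ) - w) / ((m i : ℂ) + w)) := by
    intro w hw hne
    simp only [H]
    rw [Finset.sum_mul]
    refine Finset.sum_congr rfl fun j hj => ?_
    rw [← Finset.mul_prod_erase F _ hj]
    have h1 := hne j hj
    have h2 := ofReal_add_ne_zero_of_re_nonneg (hm j hj) hw
    rw [← mul_assoc]
    congr 1
    field_simp
  have hdiff : ∀ w : ℂ, 0 ≤ w.re → DifferentiableAt ℂ H w := by
    intro w hw
    refine DifferentiableAt.fun_sum fun j hj => ?_
    refine DifferentiableAt.fun_mul ?_ ?_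
    · exact (differentiableAt_const _).fun_div (by fun_prop)
        (ofReal_add_ne_zero_of_re_nonneg (hm j hj) hw)
    · refine DifferentiableAt.fun_finsetProd fun i hi => ?_
      exact DifferentiableAt.fun_div (by fun_prop) (by fun_prop)
        (ofReal_add_ne_zero_of_re_nonneg (hm i (Finset.mem_of_mem_erase hi)) hw)
  have hbdd : ∀ w : ℂ, 0 ≤ w.re → ‖H w‖ ≤ ∑ j ∈ F, |a j| / m j := by
    intro w hw
    refine (norm_sum_le _ _).trans (Finset.sum_le_sum fun j hj => ?_)
    rw [norm_mul, norm_div, Complex.norm_real, Real.norm_eq_abs, norm_prod]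
    have h1 : m j ≤ ‖(m j : ℂ) + w‖ := by
      refine le_trans ?_ (Complex.re_le_norm _)
      simpa using hw
    have h2 : ∏ i ∈ F.erase j, ‖((m i : ℂ) - w) / ((m i : ℂ) + w)‖ ≤ 1 := by
      refine Finset.prod_le_one (fun _ _ => norm_nonneg _) fun i hi => ?_
      rw [norm_div]
      exact div_le_one_of_le₀ (norm_sub_le_norm_add_of_re_nonneg
        (hm i (Finset.mem_of_mem_erase hi)).le hw) (norm_nonneg _)
    have := hm j hj
    calc _ ≤ |a j| / ‖(m j : ℂ) + w‖ * 1 := by gcongr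
      _ ≤ |a j| / m j := by rw [mul_one]; gcongr
  have hcl : closure {z : ℂ | 0 < z.re} ⊆ {z : ℂ | 0 ≤ z.re} :=
    closure_minimal (fun z (hz : 0 < z.re) => hz.le)
      (isClosed_le continuous_const Complex.continuous_re)
  have hHC : ‖H w‖ ≤ C := by
    refine PhragmenLindelof.right_half_plane_of_bounded_on_real ?_ ?_ ?_ ?_ hw
    · exact DifferentiableOn.diffContOnCl fun z hz =>
        (hdiff z (hcl hz)).differentiableWithinAt
    · refine ⟨1, one_lt_two, 0, Asymptotics.IsBigO.of_bound (∑ j ∈ F, |a j| / m j) ?_⟩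
      filter_upwards [mem_inf_of_right (mem_principal_self _)] with z hz
      simpa using hbdd z (le_of_lt hz)
    · refine isBoundedUnder_of_eventually_le (a := ∑ j ∈ F, |a j| / m j) ?_
      filter_upwards [eventually_ge_atTop 0] with x hx
      exact hbdd x (by simpa using hx)
    · intro y
      have hre : ((y : ℂ) * Complex.I).re = 0 := by simp
      have hadd : ∀ i ∈ F, (m i : ℂ) + y * Complex.I ≠ 0 := fun i hi =>
        ofReal_add_ne_zero_of_re_nonneg (hm i hi) hre.ge
      rw [hH _ hre.ge fun i hi => by
        rw [← norm_ne_zero_iff, norm_sub_eq_norm_add_of_re_eq_zero, norm_ne_zero_iff]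
        exact hadd i hi, norm_mul, norm_prod, Finset.prod_eq_one, mul_one]
      · exact hC y
      · intro i hi
        rw [norm_div, norm_sub_eq_norm_add_of_re_eq_zero,
          div_self (norm_ne_zero_iff.2 (hadd i hi))]
  rw [hH w hw hmw, norm_mul, norm_prod] at hHC
  have hpos : 0 < ∏ i ∈ F, ‖((m i : ℂ) - w) / ((m i : ℂ) + w)‖ :=
    Finset.prod_pos fun i hi => norm_pos_iff.2
      (div_ne_zero (hmw i hi) (ofReal_add_ne_zero_of_re_nonneg (hm i hi) hw))
  rw [← le_div_iff₀ hpos, div_eq_mul_inv, ← Finset.prod_inv_distrib] at hHC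
  simpa only [norm_div, inv_div] using hHC

/-- On the rays `arg z = ±π/4` each Blaschke factor is `1 + O((1 + |z|) / l)`, so the summability
of the `1 / l i` bounds the Cauchy transform of an exponential sum by `C exp (O(1 + |z|))`,
uniformly in the number of terms. -/
theorem norm_sum_div_sub_le_exp {ι : Type*} [DecidableEq ι] {F : Finset ι} {a l : ι → ℝ}
    {C K : ℝ} (hl : ∀ i ∈ F, 0 < l i) (hK : ∑ i ∈ F, 1 / l i ≤ K)
    (hC : ∀ s : ℝ, 0 ≤ s → |∑ i ∈ F, a i * Real.exp (-(l i * s))| ≤ C)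
    {z : ℂ} (hz : 0 ≤ z.re) (hzim : |z.im| = z.re) :
    ‖∑ i ∈ F, (a i : ℂ) / ((l i : ℂ) - z)‖ ≤ C * Real.exp (4 * K * (1 + z.re)) := by
  have hC0 : 0 ≤ C := (abs_nonneg _).trans (hC 0 le_rfl)
  have him : z.im ^ 2 = z.re ^ 2 := by rw [← sq_abs, hzim]
  -- The distance from `l i` to the rays `arg z = ±π/4` is `l i / √2`.
  have hdist : ∀ i ∈ F, l i ≤ Real.sqrt 2 * ‖(l i : ℂ) - z‖ := by
    intro i hi
    refine (sq_le_sq₀ (hl i hi).le (by positivity)).1 ?_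
    rw [mul_pow, Real.sq_sqrt (by norm_num), ← Complex.normSq_eq_norm_sq, Complex.normSq_apply]
    simp
    nlinarith [sq_nonneg (l i - 2 * z.re)]
  have hne : ∀ i ∈ F, (l i : ℂ) - z ≠ 0 := by
    intro i hi h
    have := hdist i hi
    rw [h, norm_zero, mul_zero] at this
    exact absurd (hl i hi) this.not_gt
  -- The half plane `Re z > -1` is moved to `Re w > 0`, which moves the poles to `l i + 1`.
  have hshift : ∀ i, ((l i + 1 : ℝ) : ℂ) - (z + 1) = l i - z := fun i => by push_cast; ring
  have h := norm_sum_div_sub_le_prod (F := F) (a := a) (m := fun i => l i + 1) (C := C) (w := z + 1)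
    (fun i hi => by have := hl i hi; positivity)
    (fun y => by simpa using norm_sum_div_le_of_abs_sum_exp_le hl hC y)
    (by simp; linarith) (fun i hi => by rw [hshift]; exact hne i hi)
  simp only [hshift] at h
  refine h.trans (mul_le_mul_of_nonneg_left ?_ hC0)
  have hs2 : Real.sqrt 2 * Real.sqrt 2 = 2 := Real.mul_self_sqrt (by norm_num)
  have hs2' : Real.sqrt 2 ≤ 2 := by nlinarith [Real.sqrt_nonneg 2]
  have hnz : ‖1 + z‖ ≤ Real.sqrt 2 * (1 + z.re) := by
    refine (sq_le_sq₀ (norm_nonneg _) (by positivity)).1 ?_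
    rw [mul_pow, Real.sq_sqrt (by norm_num), ← Complex.normSq_eq_norm_sq, Complex.normSq_apply]
    simp
    nlinarith
  calc _ ≤ ∏ i ∈ F, Real.exp (4 * (1 + z.re) * (1 / l i)) := by
        refine Finset.prod_le_prod (fun _ _ => by positivity) fun i hi => ?_
        have hli := hl i hi
        have hd : 0 < ‖(l i : ℂ) - z‖ := norm_pos_iff.2 (hne i hi)
        have e : ((l i + 1 : ℝ) : ℂ) + (z + 1) = ((l i : ℂ) - z) + 2 * (1 + z) := by
          push_cast; ring
        have h1 : ‖((l i + 1 : ℝ) : ℂ) + (z + 1)‖ ≤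
            ‖(l i : ℂ) - z‖ + 2 * (Real.sqrt 2 * (1 + z.re)) := by
          rw [e]
          refine (norm_add_le _ _).trans ?_
          rw [norm_mul]
          simpa using hnz
        have h2 : 2 * (Real.sqrt 2 * (1 + z.re)) ≤
            4 * (1 + z.re) * (1 / l i) * ‖(l i : ℂ) - z‖ := by
          have h3 : 1 ≤ Real.sqrt 2 * ‖(l i : ℂ) - z‖ / l i := by
            rw [one_le_div hli]; exact hdist i hi
          calc 2 * (Real.sqrt 2 * (1 + z.re))
              ≤ 2 * (Real.sqrt 2 * (1 + z.re)) * (Real.sqrt 2 * ‖(l i : ℂ) - z‖ / l i) :=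
                le_mul_of_one_le_right (by positivity) h3
            _ = 2 * (Real.sqrt 2 * Real.sqrt 2) * (1 + z.re) * (1 / l i) * ‖(l i : ℂ) - z‖ := by
                ring
            _ = _ := by rw [hs2]; ring
        rw [div_le_iff₀ hd]
        calc _ ≤ (4 * (1 + z.re) * (1 / l i) + 1) * ‖(l i : ℂ) - z‖ := by linarith
          _ ≤ _ := mul_le_mul_of_nonneg_right (Real.add_one_le_exp _) hd.le
    _ = Real.exp (4 * (1 + z.re) * ∑ i ∈ F, 1 / l i) := by
        rw [← Real.exp_sum, Finset.mul_sum]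
    _ ≤ _ := by
        rw [Real.exp_le_exp]
        calc _ ≤ 4 * (1 + z.re) * K := by gcongr
          _ = _ := by ring

/-! ### Uniform decay of bounded exponential sums -/

/-- Residue representation of an exponential sum through its Cauchy transform. -/
theorem triangleIntegral_exp_mul_sum {ι : Type*} {F : Finset ι} {a l : ι → ℝ} {X : ℝ} (s : ℝ)
    (hl : ∀ i ∈ F, 0 < l i) (hX : ∀ i ∈ F, l i < X) :
    triangleIntegral (fun z => Complex.exp (-(z * s)) * ∑ i ∈ F, (a i : ℂ) / (l i - z)) X =
      -(2 * Real.pi * Complex.I) * (∑ i ∈ F, a i * Real.exp (-(l i * s)) : ℝ) := by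
  have hf : ∀ z : ℂ, Complex.exp (-(z * s)) * ∑ i ∈ F, (a i : ℂ) / (l i - z) =
      ∑ i ∈ F, (a i * Complex.exp (-(z * s))) / (l i - z) := by
    intro z
    rw [Finset.mul_sum]
    exact Finset.sum_congr rfl fun i _ => by ring
  simp only [hf]
  rw [triangleIntegral_sum (f := fun i z => (a i * Complex.exp (-(z * s))) / (l i - z))]
  · push_cast
    rw [Finset.mul_sum]
    refine Finset.sum_congr rfl fun i hi => ?_
    exact triangleIntegral_div_sub (g := fun z => a i * Complex.exp (-(z * s))) (by fun_prop)
      (hl i hi) (hX i hi)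
  · intro i hi
    exact Continuous.div (by fun_prop) (by fun_prop) fun x =>
      Complex.slitPlane_ne_zero (sub_one_sub_I_mul_mem_slitPlane (hl i hi) x)
  · intro i hi
    refine Continuous.div (by fun_prop) (by fun_prop) fun x => ?_
    rw [← neg_sub]
    exact neg_ne_zero.2 (Complex.slitPlane_ne_zero (add_I_mul_sub_mem_slitPlane (hX i hi) x))
  · intro i hi
    exact Continuous.div (by fun_prop) (by fun_prop) fun x =>
      Complex.slitPlane_ne_zero (sub_one_add_I_mul_mem_slitPlane (hl i hi) x)

theorem norm_integral_ray_le {f : ℂ → ℂ} {b : ℂ} {B c X : ℝ} (hb : ‖b‖ = Real.sqrt 2)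
    (hB : 0 ≤ B) (hc : 0 < c) (hX : 0 ≤ X)
    (hf : ∀ x : ℝ, 0 ≤ x → ‖f (b * x)‖ ≤ B * Real.exp (-c * x)) :
    ‖∫ x in (0 : ℝ)..X, b * f (b * x)‖ ≤ Real.sqrt 2 * B / c := by
  calc _ ≤ ∫ x in (0 : ℝ)..X, Real.sqrt 2 * B * Real.exp (-c * x) := by
        refine intervalIntegral.norm_integral_le_of_norm_le hX
          (Filter.Eventually.of_forall fun x hx => ?_)
          (Continuous.intervalIntegrable (by fun_prop) _ _)
        rw [norm_mul, hb, mul_assoc]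
        exact mul_le_mul_of_nonneg_left (hf x hx.1.le) (Real.sqrt_nonneg _)
    _ = Real.sqrt 2 * B * ((1 - Real.exp (-c * X)) / c) := by
        rw [intervalIntegral.integral_const_mul,
          intervalIntegral.integral_comp_mul_left Real.exp (neg_ne_zero.2 hc.ne'), integral_exp]
        simp only [mul_zero, Real.exp_zero, smul_eq_mul]
        field_simp
        ring
    _ ≤ Real.sqrt 2 * B * (1 / c) := by
        gcongr
        linarith [Real.exp_pos (-c * X)]
    _ = _ := by ring

/-- An exponential sum bounded by `C` on the half line is
`O(C / s)` at infinity, with constants depending on its exponents only through a bound `K` for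
the sum of their reciprocals. In the residue representation the Cauchy transform grows at most like
`exp (4 K x)` along the slanted sides, which `exp (-x s)` beats once `s > 4 K`; the vertical side
vanishes as the triangle grows. -/
theorem abs_sum_exp_le_div {ι : Type*} [DecidableEq ι] {F : Finset ι} {a l : ι → ℝ}
    {C K : ℝ} (hl : ∀ i ∈ F, 0 < l i) (hK : ∑ i ∈ F, 1 / l i ≤ K)
    (hC : ∀ s : ℝ, 0 ≤ s → |∑ i ∈ F, a i * Real.exp (-(l i * s))| ≤ C)
    {s : ℝ} (hs : 4 * K < s) :
    |∑ i ∈ F, a i * Real.exp (-(l i * s))| ≤ C * Real.exp (4 * K) / (s - 4 * K) := by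
  have hC0 : 0 ≤ C := (abs_nonneg _).trans (hC 0 le_rfl)
  have hK0 : 0 ≤ K := (Finset.sum_nonneg fun i hi => (by have := hl i hi; positivity)).trans hK
  have hs0 : 0 < s := by linarith
  have hc : 0 < s - 4 * K := by linarith
  set B := C * Real.exp (4 * K) with hBdef
  have hB : 0 ≤ B := by positivity
  set f : ℂ → ℂ := fun z => Complex.exp (-(z * s)) * ∑ i ∈ F, (a i : ℂ) / (l i - z) with hf
  have hray : ∀ b : ℂ, b.re = 1 → |b.im| = 1 → ∀ x : ℝ, 0 ≤ x →
      ‖f (b * x)‖ ≤ B * Real.exp (-(s - 4 * K) * x) := by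
    intro b hre him x hx
    have h1 : (b * x).re = x := by simp [hre]
    have h2 : |(b * x).im| = x := by simp [abs_mul, him, abs_of_nonneg hx]
    have h := norm_sum_div_sub_le_exp hl hK hC (z := b * x) (h1.symm ▸ hx) (h2.trans h1.symm)
    rw [h1] at h
    have h3 : (-(b * x * s) : ℂ).re = -(x * s) := by
      rw [Complex.neg_re, Complex.re_mul_ofReal, h1]
    simp only [hf]
    rw [norm_mul, Complex.norm_exp, h3]
    calc _ ≤ Real.exp (-(x * s)) * (C * Real.exp (4 * K * (1 + x))) := by gcongr
      _ = C * (Real.exp (-(x * s)) * Real.exp (4 * K * (1 + x))) := by ring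
      _ = C * (Real.exp (4 * K) * Real.exp (-(s - 4 * K) * x)) := by
          rw [← Real.exp_add, ← Real.exp_add]; ring_nf
      _ = _ := by rw [hBdef]; ring
  have hnorm : ∀ b : ℂ, b.re = 1 → |b.im| = 1 → ‖b‖ = Real.sqrt 2 := by
    intro b hre him
    rw [Complex.norm_def, Complex.normSq_apply, hre, ← abs_mul_abs_self b.im, him]
    norm_num
  set A := ∑ i ∈ F, |a i| with hA
  have hvert : ∀ X : ℝ, 0 ≤ X → (∀ i ∈ F, l i + 1 ≤ X) →
      ‖∫ y in (-X)..X, Complex.I * f (X + Complex.I * y)‖ ≤ A * Real.exp (-s * X) * (2 * X) := by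
    intro X hX hlX
    have h := intervalIntegral.norm_integral_le_of_norm_le_const (a := -X) (b := X)
      (f := fun y : ℝ => Complex.I * f (X + Complex.I * y)) (C := A * Real.exp (-s * X))
      fun y _ => by
        have h3 : (-((X + Complex.I * y) * s) : ℂ).re = -s * X := by simp; ring
        simp only [hf]
        rw [norm_mul, Complex.norm_I, one_mul, norm_mul, Complex.norm_exp, h3, mul_comm]
        gcongr
        refine (norm_sum_le _ _).trans (Finset.sum_le_sum fun i hi => ?_)
        rw [norm_div, Complex.norm_real, Real.norm_eq_abs]
        refine div_le_self (abs_nonneg _) ?_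
        have h4 := Complex.re_le_norm (-((l i : ℂ) - (X + Complex.I * y)))
        rw [norm_neg] at h4
        refine le_trans ?_ h4
        have := hlX i hi
        simp
        linarith
    rwa [show |X - -X| = 2 * X by rw [sub_neg_eq_add, ← two_mul, abs_of_nonneg (by linarith)]] at h
  have hmain : ∀ᶠ X : ℝ in atTop, 2 * Real.pi * |∑ i ∈ F, a i * Real.exp (-(l i * s))| ≤
      2 * (Real.sqrt 2 * B / (s - 4 * K)) + 2 * A * (X ^ (1 : ℝ) * Real.exp (-s * X)) := by
    filter_upwards [eventually_ge_atTop (0 : ℝ),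
      (Filter.eventually_all_finset F).2 fun i _ => eventually_ge_atTop (l i + 1)] with X hX hlX
    have hres := triangleIntegral_exp_mul_sum (a := a) (X := X) s hl
      fun i hi => by linarith [hlX i hi]
    have hn := congrArg norm hres
    rw [norm_mul, Complex.norm_real, Real.norm_eq_abs, norm_neg, norm_mul, norm_mul,
      Complex.norm_I, Complex.norm_real, Real.norm_of_nonneg Real.pi_pos.le] at hn
    simp only [Complex.norm_ofNat, mul_one] at hn
    rw [← hn, triangleIntegral]
    refine (norm_sub_le _ _).trans ((add_le_add_left (norm_add_le _ _) _).trans ?_)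
    have hL := norm_integral_ray_le (hnorm (1 - Complex.I) (by simp) (by simp)) hB hc hX
      (hray (1 - Complex.I) (by simp) (by simp))
    have hU := norm_integral_ray_le (hnorm (1 + Complex.I) (by simp) (by simp)) hB hc hX
      (hray (1 + Complex.I) (by simp) (by simp))
    have hV := hvert X hX hlX
    rw [Real.rpow_one]
    linarith
  have hlim : Tendsto (fun X : ℝ => 2 * (Real.sqrt 2 * B / (s - 4 * K)) +
      2 * A * (X ^ (1 : ℝ) * Real.exp (-s * X))) atTop
      (𝓝 (2 * (Real.sqrt 2 * B / (s - 4 * K)) + 2 * A * 0)) :=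
    ((tendsto_rpow_mul_exp_neg_mul_atTop_nhds_zero 1 s hs0).const_mul _).const_add _
  have h := ge_of_tendsto hlim hmain
  rw [mul_zero, add_zero, mul_div_assoc] at h
  have hq : 0 ≤ B / (s - 4 * K) := by positivity
  have hsqrt : Real.sqrt 2 ≤ 3 := by
    rw [Real.sqrt_le_left (by norm_num)]; norm_num
  have hpi := Real.pi_gt_three
  have hp := abs_nonneg (∑ i ∈ F, a i * Real.exp (-(l i * s)))
  nlinarith [mul_le_mul_of_nonneg_right hsqrt hq, mul_le_mul_of_nonneg_right hpi.le hp]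

/-! ### Müntz spaces -/

theorem IsMuntzSequence.pos {Λ : ℕ → ℝ≥0} (hΛ : IsMuntzSequence Λ) (i : ℕ) :
    0 < (Λ (i + 1) : ℝ) := by
  have h := hΛ.strictMono (Nat.succ_pos i)
  rw [hΛ.zero] at h
  exact_mod_cast h

/-- The unit ball of `M₀(Λ)` is small near `0`: a Müntz polynomial becomes an exponential sum
under `t = e^{-s}`, and the bound for those is independent of the number of terms. -/
theorem exists_abs_apply_le_half_norm {Λ : ℕ → ℝ≥0} (hΛ : IsMuntzSequence Λ) :
    ∃ δ : ℝ, 0 < δ ∧ ∀ y ∈ muntzSpaceZero Λ, ∀ t : I, (t : ℝ) ≤ δ → |y t| ≤ 1 / 2 * ‖y‖ := by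
  set K := ∑' i : ℕ, 1 / (Λ (i + 1) : ℝ) with hKdef
  -- For `s ≥ S` the factor `e^{4K} / (s - 4K)` is at most `1 / 2`.
  set S := 4 * K + 2 * Real.exp (4 * K) with hS
  refine ⟨Real.exp (-S), Real.exp_pos _, fun y hy t ht => ?_⟩
  have hclosed : IsClosed {y : C(I, ℝ) | |y t| ≤ 1 / 2 * ‖y‖} :=
    isClosed_le (continuous_eval_const t).abs (continuous_norm.const_mul _)
  refine closure_minimal (fun y hy => ?_) hclosed hy
  obtain ⟨c, rfl⟩ := Finsupp.mem_span_range_iff_exists_finsupp.1 hy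
  set P : C(I, ℝ) := c.sum fun i a => a • muntzPower (Λ (i + 1)) with hP
  have hval : ∀ t : I, P t = ∑ i ∈ c.support, c i * (t : ℝ) ^ (Λ (i + 1) : ℝ) := by
    intro t
    simp [hP, Finsupp.sum, ContinuousMap.sum_apply, muntzPower]
  have hexp : ∀ (t : I) (s : ℝ), (t : ℝ) = Real.exp (-s) →
      P t = ∑ i ∈ c.support, c i * Real.exp (-((Λ (i + 1) : ℝ) * s)) := by
    intro t s hts
    rw [hval]
    refine Finset.sum_congr rfl fun i _ => ?_
    rw [hts, ← Real.exp_mul]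
    ring_nf
  show |P t| ≤ 1 / 2 * ‖P‖
  rcases eq_or_lt_of_le t.2.1 with h0 | h0
  · have : P t = 0 := by
      rw [hval, ← h0]
      exact Finset.sum_eq_zero fun i _ => by rw [Real.zero_rpow (hΛ.pos i).ne', mul_zero]
    rw [this, abs_zero]
    positivity
  · have hlog : (t : ℝ) = Real.exp (-(-Real.log t)) := by rw [neg_neg, Real.exp_log h0]
    have hs : S ≤ -Real.log t := by
      have := (Real.log_le_iff_le_exp h0).2 ht
      linarith
    have hC : ∀ s : ℝ, 0 ≤ s →
        |∑ i ∈ c.support, c i * Real.exp (-((Λ (i + 1) : ℝ) * s))| ≤ ‖P‖ := by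
      intro s hs
      have hmem : Real.exp (-s) ∈ I := ⟨(Real.exp_pos _).le, by simpa using hs⟩
      rw [← hexp ⟨_, hmem⟩ s rfl]
      exact P.norm_coe_le_norm _
    have hE := Real.exp_pos (4 * K)
    have h := abs_sum_exp_le_div (F := c.support) (a := c) (l := fun i => (Λ (i + 1) : ℝ))
      (K := K) (fun i _ => hΛ.pos i)
      (hΛ.summable.sum_le_tsum _ fun i _ => (one_div_pos.2 (hΛ.pos i)).le) hC
      (s := -Real.log t) (by linarith)
    rw [← hexp t _ hlog] at h
    refine h.trans ?_
    rw [div_le_iff₀ (by linarith)]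
    nlinarith [norm_nonneg P]

/-- Suppose that at each point either `x` is at least `1 - q > 0` or all `y ∈ X` are at most
`q ‖y‖` in modulus. Then a `y` of norm close to `1` must peak where `x ≥ 1 - q`, which makes one
of `‖x + y‖`, `‖x - y‖` exceed `1` by a fixed amount. -/
theorem not_isAlmostSquare_of_abs_apply_le {X : Submodule ℝ C(I, ℝ)} {x : C(I, ℝ)} (hxX : x ∈ X)
    (hx : ‖x‖ = 1) {q : ℝ} (hq0 : 0 ≤ q) (hq : q < 1)
    (h : ∀ y ∈ X, ∀ t, |y t| ≤ q * ‖y‖ ∨ 1 - q ≤ x t) : ¬ IsAlmostSquare X := by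
  intro hX
  obtain ⟨y, -, hy, hxy⟩ := hX 1 le_rfl (fun _ => ⟨x, hxX⟩) fun _ => by simpa using hx
  obtain ⟨hadd, hsub⟩ := hxy 0
  have hle : ∀ n, ‖y n‖ ≤ max (q * ‖y n‖)
      (max ‖(⟨x, hxX⟩ : X) + y n‖ ‖(⟨x, hxX⟩ : X) - y n‖ - (1 - q)) := by
    intro n
    refine (ContinuousMap.norm_le _ (le_max_of_le_left (by positivity))).2 fun t => ?_
    rw [Real.norm_eq_abs]
    rcases h _ (y n).2 t with ht | ht
    · exact le_max_of_le_left ht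
    · refine le_max_of_le_right ?_
      have h1 := (x + (y n : C(I, ℝ))).norm_coe_le_norm t
      have h2 := (x - (y n : C(I, ℝ))).norm_coe_le_norm t
      have h3 := (le_abs_self _).trans h1
      have h4 := (le_abs_self _).trans h2
      simp only [ContinuousMap.add_apply, ContinuousMap.sub_apply] at h3 h4
      have h5 := le_max_left ‖x + (y n : C(I, ℝ))‖ ‖x - (y n : C(I, ℝ))‖
      have h6 := le_max_right ‖x + (y n : C(I, ℝ))‖ ‖x - (y n : C(I, ℝ))‖
      change |(y n : C(I, ℝ)) t| ≤ max ‖x + (y n : C(I, ℝ))‖ ‖x - (y n : C(I, ℝ))‖ - (1 - q)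
      rcases abs_cases ((y n : C(I, ℝ)) t) with ⟨h7, -⟩ | ⟨h7, -⟩ <;> linarith
  have hlim := le_of_tendsto_of_tendsto' hy
    ((hy.const_mul q).max ((hadd.max hsub).sub_const (1 - q))) hle
  rw [max_self, mul_one, sub_sub_cancel, max_self] at hlim
  linarith

theorem norm_muntzPower (a : ℝ≥0) : ‖muntzPower a‖ = 1 := by
  refine le_antisymm ((ContinuousMap.norm_le _ zero_le_one).2 fun t => ?_) ?_
  · change ‖(t : ℝ) ^ (a : ℝ)‖ ≤ 1
    rw [Real.norm_of_nonneg (Real.rpow_nonneg t.2.1 _)]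
    exact Real.rpow_le_one t.2.1 t.2.2 a.2
  · simpa [muntzPower] using (muntzPower a).norm_coe_le_norm 1

theorem mainTheorem3 (Λ : ℕ → ℝ≥0) (hΛ : IsMuntzSequence Λ) :
    ¬ IsAlmostSquare (muntzSpace Λ) ∧ ¬ IsAlmostSquare (muntzSpaceZero Λ) := by
  constructor
  · refine not_isAlmostSquare_of_abs_apply_le (x := muntzPower (Λ 0)) (q := 0)
      (Submodule.le_topologicalClosure _ (Submodule.subset_span ⟨0, rfl⟩)) (norm_muntzPower _)
      le_rfl zero_lt_one fun y _ t => Or.inr ?_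
    simp [hΛ.zero, muntzPower]
  · obtain ⟨δ, hδ, h⟩ := exists_abs_apply_le_half_norm hΛ
    have hpow : 0 < δ ^ (Λ 1 : ℝ) := Real.rpow_pos_of_pos hδ _
    refine not_isAlmostSquare_of_abs_apply_le (x := muntzPower (Λ 1))
      (q := max (1 / 2) (1 - δ ^ (Λ 1 : ℝ)))
      (Submodule.le_topologicalClosure _ (Submodule.subset_span ⟨0, rfl⟩)) (norm_muntzPower _)
      (le_max_of_le_left (by norm_num)) (max_lt (by norm_num) (by linarith)) fun y hy t => ?_
    rcases le_total (t : ℝ) δ with ht | ht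
    · left
      exact (h y hy t ht).trans (mul_le_mul_of_nonneg_right (le_max_left _ _) (norm_nonneg _))
    · right
      have h1 : δ ^ (Λ 1 : ℝ) ≤ (t : ℝ) ^ (Λ 1 : ℝ) := Real.rpow_le_rpow hδ.le ht (Λ 1).2
      have h2 := le_max_right (1 / 2) (1 - δ ^ (Λ 1 : ℝ))
      change _ ≤ (t : ℝ) ^ (Λ 1 : ℝ)
      linarith
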